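/- **Setting.** Fix $r,\mu,\delta\in\mathbb R$, $\sigma>0$, $S\in(0,\infty)\setminus\{1\}$ and transaction cost parameters $\gamma^\uparrow,\gamma^\downarrow\in[1,\infty)$ with $\xi:=\gamma^\uparrow\gamma^\downarrow$, and put $\lambda:=(\mu-r)/\sigma$. The relative risk aversion $R\in(0,\infty)\setminus\{1\}$ varies subject to $\theta:=\frac{1-R}{1-S}>0$. Put $q_M:=\frac{\lambda}{R\sigma}$, $$m(q):=\frac{\delta}{S}-\frac{1-S}{S}\Big(r+\lambda\sigma q-\frac{q^2\sigma^2}{2}R\Big),\qquad \ell(q):=m(q)+\frac{1-S}{S}\frac{\sigma^2}{2}q(1-q);$$ these depend on $R$, but $m(0)$ does not. *Well-posedness.* Let $\bar\xi:=1$ if $m$ has at most one zero, and $\bar\xi:=\exp\int_{q_-}^{q_+}-\frac{1}{q(1-q)}\frac{m(q)}{\ell(q)}\,dq$ if $m$ has two zeros $q_-<q_+$ (with $\bar\xi:=\infty$ if the integrand is not absolutely integrable). The problem is well-posed for $R$ if $\xi>1$ and either $R<1$, $m(0)>0$, $m(1)>0$, $\xi>\bar\xi$, or $R>1$, $m(q_M)>0$,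 $\xi<\bar\xi$. *Boundaries.* In the well-posed case let $q_*<q^*$ and the continuously differentiable function $n:[q_*,q^*]\to(0,\infty)$ solve the free boundary problem: $0<q_*<q_M<q^*<1$ if $q_M\in(0,1)$; $0<q_*<q^*=1$ if $q_M=1$; $0<q_*<q_M<q^*<2q_M-1$ if $q_M>1$; $2q_M<q_*<q_M<q^*<0$ if $q_M<0$; $n$ is decreasing if $R<1$ and increasing if $R>1$; for $q\in[q_*,q^*]\setminus\{1\}$, $n(q)\ne\ell(q)$ and $n'(q)=\frac{1-S}{S}\frac{n(q)}{1-q}\frac{m(q)-n(q)}{\ell(q)-n(q)}$; $n=m$ at $q_*$ and at $q^*$, and $n'=0$ at each of these two points that is different from $1$; if $1\in[q_*,q^*]$, then $n(1)=m(1)$ and $n'(1)=m'(1)$; and $\xi=\exp\int_{q_*}^{q^*}-\frac1{q(1-q)}\frac{m(q)-n(q)}{\ell(q)-n(q)}\,dq$. The optimal purchase and sale boundaries (as fractions of wealth in the risky asset) are $$p_*=\frac{q_*}{\gamma^\uparrow+(1-\gamma^\uparrow)q_*},\qquad p^*=\frac{\gamma^\downarrow q^*}{1+(\gamma^\downarrow-1)q^*}.$$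 *Sufficient condition.* Let $c(q):=\ell(q)+\frac{(S-1)q}{2S-(S+1)q}\,(m(q)-\ell(q))$. We say that the sufficient condition holds for $R$ if (a) $S<1$, or (b) $S>1$, $m(0)>0$ and at least one of the following holds: (i) $2c(q)-qc'(q)>0$ for all $q\in(0,1)$ if $q_M\le1$, respectively for all $q\in(0,\frac{2S}{S+1})$ if $q_M>1$; (ii) $R\ge2$; (iii) $\ell'(0)\ge0$. **Proposition 7.3.** Let $\lambda>0$, and let $\hat R>\tilde R$ be such that the problems for $R=\hat R$ and for $R=\tilde R$ (all other parameters being the same) are well-posed, with boundaries $(\hat p_*,\hat p^*)$ and $(\tilde p_*,\tilde p^*)$. If the sufficient condition holds for $R=\hat R$ and for $R=\tilde R$, then $\hat p_*\le\tilde p_*$ and $\hat p^*\le\tilde p^*$. Consequently, over those $R$ for which the problem is well-posed: 1. If $S<1$, then $p_*$ and $p^*$ are non-increasing in $R\in(0,1)$. 2. If $S>1$ and $m(0)>0$, then $p_*$ and $p^*$ are non-increasing in $R\in[2,\infty)$; if also $\lambda\ge\frac{\sigma}{2}$, they are non-increasing in $R\in(1,\infty)$. -/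

import Mathlib

open Set MeasureTheory

noncomputable section

namespace EpsteinZin

/-- All parameters of the investment-consumption problem under Epstein--Zin utility with
proportional transaction costs, except the relative risk aversion `R`: interest rate `r`, drift
`μ` and volatility `σ` of the risky asset, discount parameter `δ`, elasticity of intertemporal
complementarity `S`, and transaction cost parameters `γup` (buying) and `γdn` (selling). -/
structure Market where
  r : ℝ
  μ : ℝ
  σ : ℝ
  δ : ℝ
  S : ℝ
  γup : ℝ
  γdn : ℝ
  σ_pos : 0 < σ
  S_pos : 0 < S
  S_ne_one : S ≠ 1
  one_le_γup : 1 ≤ γup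
  one_le_γdn : 1 ≤ γdn

namespace Market

/-- The market price of risk. -/
def lam (P : Market) : ℝ := (P.μ - P.r) / P.σ

/-- The round-trip transaction cost. -/
def ξ (P : Market) : ℝ := P.γup * P.γdn

/-- The parameter `θ = (1 - R) / (1 - S)` of the Epstein--Zin aggregator. -/
def θ (P : Market) (R : ℝ) : ℝ := (1 - R) / (1 - P.S)

/-- The admissible coefficients of relative risk aversion: `R ∈ (0, ∞) \ {1}` and `θ > 0`. -/
def AdmissibleR (P : Market) (R : ℝ) : Prop := 0 < R ∧ R ≠ 1 ∧ 0 < P.θ R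

/-- The Merton ratio. -/
def qM (P : Market) (R : ℝ) : ℝ := P.lam / (R * P.σ)

/-- The optimal consumption rate per unit of wealth in the frictionless problem, when the constant
fraction `q` of wealth is invested in the risky asset. -/
def m (P : Market) (R q : ℝ) : ℝ :=
  P.δ / P.S - (1 - P.S) / P.S * (P.r + P.lam * P.σ * q - q ^ 2 * P.σ ^ 2 / 2 * R)

/-- The quadratic `ℓ`, where `α = δ - r (1 - S)` is the effective impatience rate. -/
def ell (P : Market) (R q : ℝ) : ℝ :=
  (P.δ - P.r * (1 - P.S)) / P.S
    - (1 - P.S) / P.S * (P.lam * P.σ - P.σ ^ 2 / 2) * q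
    - (1 - R) * ((1 - P.S) / P.S) * (P.σ ^ 2 / 2) * q ^ 2

/-- The right-hand side `O(n, q)` of the ODE for the optimal consumption rate. -/
def odeRHS (P : Market) (R x q : ℝ) : ℝ :=
  (1 - P.S) / P.S * (x / (1 - q)) * ((P.m R q - x) / (P.ell R q - x))

/-- The integrand in the definition of the threshold transaction cost. -/
def thresholdIntegrand (P : Market) (R q : ℝ) : ℝ :=
  -(1 / (q * (1 - q))) * (P.m R q / P.ell R q)

/-- The zeros of `m`. -/
def zerosM (P : Market) (R : ℝ) : Set ℝ := {q | P.m R q = 0}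

open Classical in
/-- The threshold transaction cost `ξ̄`. It is `1` if the quadratic `m` has at most one zero. If `m`
has two zeros `q₋ < q₊` (which are then the infimum and the supremum of the set of zeros), it is the
exponential of the integral over `[q₋, q₊]`, understood as `∞` if the integrand is not absolutely
integrable there. -/
def thresholdCost (P : Market) (R : ℝ) : EReal :=
  if (P.zerosM R).Nontrivial then
    if IntervalIntegrable (P.thresholdIntegrand R) volume
        (sInf (P.zerosM R)) (sSup (P.zerosM R)) then
      ((Real.exp (∫ q in (sInf (P.zerosM R))..(sSup (P.zerosM R)),
        P.thresholdIntegrand R q) : ℝ) : EReal)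
    else ⊤
  else 1

/-- Well-posedness of the problem: the round-trip cost `ξ ∈ (1, ∞)` lies in the well-posedness range
of transaction costs. -/
def WellPosed (P : Market) (R : ℝ) : Prop :=
  1 < P.ξ ∧
    ((R < 1 ∧ 0 < P.m R 0 ∧ 0 < P.m R 1 ∧ P.thresholdCost R < (P.ξ : EReal)) ∨
     (1 < R ∧ 0 < P.m R (P.qM R) ∧ (P.ξ : EReal) < P.thresholdCost R))

/-- `(a, b, n)` solves the free boundary problem: `a` and `b` are the purchase and sale boundaries
`q_*` and `q^*` of the shadow no-transaction region, and `n`, of which only the values on `[a, b]`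
matter, is the optimal consumption rate per unit of shadow wealth. -/
structure IsFreeBoundarySolution (P : Market) (R a b : ℝ) (n : ℝ → ℝ) : Prop where
  lt : a < b
  loc_mid : P.qM R ∈ Ioo (0 : ℝ) 1 → 0 < a ∧ a < P.qM R ∧ P.qM R < b ∧ b < 1
  loc_one : P.qM R = 1 → 0 < a ∧ b = 1
  loc_gt : 1 < P.qM R → 0 < a ∧ a < P.qM R ∧ P.qM R < b ∧ b < 2 * P.qM R - 1
  loc_neg : P.qM R < 0 → 2 * P.qM R < a ∧ a < P.qM R ∧ P.qM R < b ∧ b < 0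
  contDiffOn : ContDiffOn ℝ 1 n (Icc a b)
  pos : ∀ q ∈ Icc a b, 0 < n q
  ne_ell : ∀ q ∈ Icc a b, q ≠ 1 → n q ≠ P.ell R q
  anti : R < 1 → AntitoneOn n (Icc a b)
  mono : 1 < R → MonotoneOn n (Icc a b)
  ode : ∀ q ∈ Icc a b, q ≠ 1 → derivWithin n (Icc a b) q = P.odeRHS R (n q) q
  left_val : n a = P.m R a
  right_val : n b = P.m R b
  /-- At a boundary point equal to `1` the slope is prescribed by `one_deriv` instead. -/
  left_deriv : a ≠ 1 → derivWithin n (Icc a b) a = 0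
  right_deriv : b ≠ 1 → derivWithin n (Icc a b) b = 0
  one_val : 1 ∈ Icc a b → n 1 = P.m R 1
  one_deriv : 1 ∈ Icc a b → derivWithin n (Icc a b) 1 = deriv (P.m R) 1
  integral_eq : P.ξ = Real.exp (∫ q in a..b,
    -(1 / (q * (1 - q))) * ((P.m R q - n q) / (P.ell R q - n q)))

/-- `pl` and `pu` are the optimal purchase and sale boundaries `p_*` and `p^*` of the no-transaction
region, expressed as fractions of wealth held in the risky asset. -/
def IsBoundaryPair (P : Market) (R pl pu : ℝ) : Prop :=
  ∃ (a b : ℝ) (n : ℝ → ℝ), P.IsFreeBoundarySolution R a b n ∧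
    pl = a / (P.γup + (1 - P.γup) * a) ∧
    pu = P.γdn * b / (1 + (P.γdn - 1) * b)

/-- The function `c`; see `odeRHS_cfun` for the equation that defines it. -/
def cfun (P : Market) (R q : ℝ) : ℝ :=
  P.ell R q + (P.S - 1) * q / (2 * P.S - (P.S + 1) * q) * (P.m R q - P.ell R q)

lemma ell_sub_m (P : Market) (R q : ℝ) :
    P.ell R q - P.m R q = (1 - P.S) / P.S * (P.σ ^ 2 / 2) * (q * (1 - q)) := by
  have := P.S_pos.ne'
  simp only [ell, m]
  field_simp
  ring

/-- `x = c(q)` solves the equation `O(x, q) / x = 2 / q`. -/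
lemma odeRHS_cfun (P : Market) (R q : ℝ) (h0 : q ≠ 0) (h1 : q ≠ 1)
    (h2 : q ≠ 2 * P.S / (P.S + 1)) :
    P.odeRHS R (P.cfun R q) q = 2 / q * P.cfun R q := by
  have hS := P.S_pos
  have hS1 : P.S - 1 ≠ 0 := sub_ne_zero.2 P.S_ne_one
  have hq : 1 - q ≠ 0 := sub_ne_zero.2 h1.symm
  have hD : 2 * P.S - (P.S + 1) * q ≠ 0 := by
    intro h
    apply h2
    rw [eq_div_iff (by positivity)]
    linarith
  have hd : P.m R q - P.ell R q ≠ 0 := by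
    have h := P.ell_sub_m R q
    have hne : (1 - P.S) / P.S * (P.σ ^ 2 / 2) * (q * (1 - q)) ≠ 0 := by
      have h3 : 1 - P.S ≠ 0 := fun h => hS1 (by linarith)
      have := P.σ_pos.ne'
      positivity
    intro h'
    apply hne
    linarith
  have e1 : P.m R q - P.cfun R q
      = 2 * P.S * (1 - q) / (2 * P.S - (P.S + 1) * q) * (P.m R q - P.ell R q) := by
    have h : 2 * P.S * (1 - q) / (2 * P.S - (P.S + 1) * q)
        = 1 - (P.S - 1) * q / (2 * P.S - (P.S + 1) * q) := by
      rw [eq_sub_iff_add_eq, ← add_div, div_eq_one_iff_eq hD]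
      ring
    rw [h, cfun]
    ring
  have e2 : P.ell R q - P.cfun R q
      = -((P.S - 1) * q / (2 * P.S - (P.S + 1) * q) * (P.m R q - P.ell R q)) := by
    simp only [cfun]; ring
  rw [odeRHS, e1, e2]
  generalize 2 * P.S - (P.S + 1) * q = D at hD
  generalize P.m R q - P.ell R q = w at hd
  field_simp
  ring

/-- `2 c(q) - q c'(q) > 0` on `(0, 1)` if `q_M ≤ 1`, and on `(0, 2S/(S+1))` if `q_M > 1`. -/
def CfunCondition (P : Market) (R : ℝ) : Prop :=
  (P.qM R ≤ 1 → ∀ q ∈ Ioo (0 : ℝ) 1, 0 < 2 * P.cfun R q - q * deriv (P.cfun R) q) ∧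
  (1 < P.qM R → ∀ q ∈ Ioo (0 : ℝ) (2 * P.S / (P.S + 1)),
    0 < 2 * P.cfun R q - q * deriv (P.cfun R) q)

/-- One of the sufficient conditions (for `2 n(q) - q n'(q) > 0`) on the parameters holds. -/
def SufficientCondition (P : Market) (R : ℝ) : Prop :=
  P.S < 1 ∨
    (1 < P.S ∧ 0 < P.m R 0 ∧ (P.CfunCondition R ∨ 2 ≤ R ∨ 0 ≤ deriv (P.ell R) 0))

/-- Both boundaries are decreasing (non-increasing) in `R` over those `R ∈ A` for which the
problem is well-posed. -/
def BoundariesDecreaseOn (P : Market) (A : Set ℝ) : Prop :=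
  ∀ R₁ ∈ A, ∀ R₂ ∈ A, R₁ < R₂ → P.AdmissibleR R₁ → P.AdmissibleR R₂ →
    P.WellPosed R₁ → P.WellPosed R₂ →
    ∀ pl₁ pu₁ pl₂ pu₂ : ℝ, P.IsBoundaryPair R₁ pl₁ pu₁ → P.IsBoundaryPair R₂ pl₂ pu₂ →
      pl₂ ≤ pl₁ ∧ pu₂ ≤ pu₁

end Market

end EpsteinZin

end

/-!
Write `κ = (1 - S) / S` and `Z = -n' / (κ n) ≥ 0`. In terms of `Z` the free boundary problem says
that `n = m + (κ σ² / 2) e(q, Z)` for a function `e` increasing in `Z`, that `Z` vanishes at the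
boundary points different from `1`, and that `∫ Z / q = log ξ`.

Let `R' < R`. Where `Z` and `Z'` agree, `e(q, Z) - e(q, Z')` has derivative
`-(R - R') q (2 + κ q Z)`, and `2 + κ q Z > 0` because `q² / n` is increasing: this is where the
sufficient condition enters, the function `c` being the value of `n` at which `2 + κ q Z = 0`.
Hence `Z - Z'` can change sign only from positive to negative. If `q_*` or `q^*` were larger for
`R` than for `R'`, then one of `Z`, `Z'` would dominate the other on a smaller interval and be
positive outside of it, so the two integrals could not both be equal to `log ξ`.
-/

noncomputable section

namespace EpsteinZin

open Filter Topology

section Propagation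

variable {X Y : Type*} [ConditionallyCompleteLinearOrder X] [TopologicalSpace X] [OrderTopology X]
  [DenselyOrdered X] [LinearOrder Y] [TopologicalSpace Y] [OrderClosedTopology Y]
  {f g : X → Y} {a b : X}

lemma le_on_Icc_of_le_left (hf : ContinuousOn f (Icc a b)) (hg : ContinuousOn g (Icc a b))
    (hfg : f a ≤ g a) (hcross : ∀ x ∈ Ico a b, f x = g x → ∀ᶠ y in 𝓝[>] x, f y ≤ g y) :
    ∀ x ∈ Icc a b, f x ≤ g x := by
  have hclosed : IsClosed ({x | f x ≤ g x} ∩ Icc a b) := by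
    rw [inter_comm]
    exact isClosed_Icc.isClosed_le hf hg
  refine hclosed.Icc_subset_of_forall_exists_gt hfg ?_
  rintro x ⟨hx, hxI⟩ y hxy
  have hright : ∀ᶠ z in 𝓝[>] x, f z ≤ g z := by
    rcases hx.out.lt_or_eq with hlt | heq
    · have hmono : 𝓝[>] x ≤ 𝓝[Icc a b] x := nhdsWithin_le_of_mem (Icc_mem_nhdsGT_of_mem hxI)
      have hxI' := Ico_subset_Icc_self hxI
      exact (((hf x hxI').mono_left hmono).eventually_lt ((hg x hxI').mono_left hmono) hlt).mono
        fun _ => le_of_lt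
    · exact hcross x hxI heq
  have hIoc : ∀ᶠ z in 𝓝[>] x, z ∈ Ioc x y := Ioc_mem_nhdsGT hxy
  have : NeBot (𝓝[>] x) := nhdsGT_neBot_of_exists_gt ⟨y, hxy⟩
  obtain ⟨z, hz, hzI⟩ := (hright.and hIoc).exists
  exact ⟨z, hz, hzI⟩

lemma le_on_Icc_of_le_right (hf : ContinuousOn f (Icc a b)) (hg : ContinuousOn g (Icc a b))
    (hfg : f b ≤ g b) (hcross : ∀ x ∈ Ioc a b, f x = g x → ∀ᶠ y in 𝓝[<] x, f y ≤ g y) :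
    ∀ x ∈ Icc a b, f x ≤ g x := by
  intro x hx
  exact le_on_Icc_of_le_left (X := Xᵒᵈ) (f := f ∘ OrderDual.ofDual) (g := g ∘ OrderDual.ofDual)
    (a := OrderDual.toDual b) (b := OrderDual.toDual a) (by rwa [Icc_toDual]) (by rwa [Icc_toDual])
    hfg (fun y hy => hcross y ⟨hy.2, hy.1⟩) (OrderDual.toDual x) ⟨hx.2, hx.1⟩

end Propagation

lemma eventually_lt_nhdsGT_of_deriv_neg {f : ℝ → ℝ} {f' x : ℝ}
    (hf : HasDerivWithinAt f f' (Ioi x) x) (hf' : f' < 0) : ∀ᶠ y in 𝓝[>] x, f y < f x := by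
  have hslope := (hasDerivWithinAt_iff_tendsto_slope' self_notMem_Ioi).1 hf
  filter_upwards [hslope.eventually_lt_const hf', self_mem_nhdsWithin] with y hy hxy
  exact (slope_neg_iff_of_le hxy.out.le).1 hy

lemma eventually_lt_nhdsLT_of_deriv_neg {f : ℝ → ℝ} {f' x : ℝ}
    (hf : HasDerivWithinAt f f' (Iio x) x) (hf' : f' < 0) : ∀ᶠ y in 𝓝[<] x, f x < f y := by
  have hslope := (hasDerivWithinAt_iff_tendsto_slope' self_notMem_Iio).1 hf
  filter_upwards [hslope.eventually_lt_const hf', self_mem_nhdsWithin] with y hy hyx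
  exact (slope_neg_iff_of_le hyx.out.le).1 (slope_comm f x y ▸ hy)

lemma integral_lt_integral_of_le_of_exists_pos_outside {f g : ℝ → ℝ} {a b c d : ℝ} (hca : c ≤ a)
    (hab : a ≤ b) (hbd : b ≤ d) (hf : ContinuousOn f (Icc a b)) (hg : ContinuousOn g (Icc c d))
    (hg_nonneg : ∀ x ∈ Icc c d, 0 ≤ g x) (hfg : ∀ x ∈ Icc a b, f x ≤ g x)
    (hg_pos : ∃ x ∈ Ioo c a ∪ Ioo b d, 0 < g x) :
    ∫ x in a..b, f x < ∫ x in c..d, g x := by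
  have hgca := hg.mono (Icc_subset_Icc_right (hab.trans hbd))
  have hgab := hg.mono (Icc_subset_Icc hca hbd)
  have hgbd := hg.mono (Icc_subset_Icc_left (hca.trans hab))
  have hle : ∫ x in a..b, f x ≤ ∫ x in a..b, g x := intervalIntegral.integral_mono_on hab
    (hf.intervalIntegrable_of_Icc hab) (hgab.intervalIntegrable_of_Icc hab) hfg
  have hsplit : ∫ x in c..d, g x =
      (∫ x in c..a, g x) + (∫ x in a..b, g x) + ∫ x in b..d, g x := by
    have hi₁ := hgca.intervalIntegrable_of_Icc (μ := volume) hca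
    have hi₂ := hgab.intervalIntegrable_of_Icc (μ := volume) hab
    rw [intervalIntegral.integral_add_adjacent_intervals hi₁ hi₂,
      intervalIntegral.integral_add_adjacent_intervals (hi₁.trans hi₂)
        (hgbd.intervalIntegrable_of_Icc hbd)]
  have hnonneg_left : ∀ x ∈ Icc c a, 0 ≤ g x := fun x hx =>
    hg_nonneg x (Icc_subset_Icc_right (hab.trans hbd) hx)
  have hnonneg_right : ∀ x ∈ Icc b d, 0 ≤ g x := fun x hx =>
    hg_nonneg x (Icc_subset_Icc_left (hca.trans hab) hx)
  have hleft := intervalIntegral.integral_nonneg (μ := volume) hca hnonneg_left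
  have hright := intervalIntegral.integral_nonneg (μ := volume) hbd hnonneg_right
  obtain ⟨x, hx | hx, hgx⟩ := hg_pos
  · have := intervalIntegral.integral_pos (hx.1.trans hx.2) hgca
      (fun y hy => hnonneg_left y (Ioc_subset_Icc_self hy)) ⟨x, Ioo_subset_Icc_self hx, hgx⟩
    linarith
  · have := intervalIntegral.integral_pos (hx.1.trans hx.2) hgbd
      (fun y hy => hnonneg_right y (Ioc_subset_Icc_self hy)) ⟨x, Ioo_subset_Icc_self hx, hgx⟩
    linarith

lemma mul_div_add_mul_le_mul_div_add_mul {α β η x y : ℝ} (hαβ : 0 ≤ α * β) (hx : 0 < β + η * x)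
    (hy : 0 < β + η * y) (hxy : x ≤ y) : α * x / (β + η * x) ≤ α * y / (β + η * y) := by
  rw [div_le_div_iff₀ hx hy]
  linear_combination mul_le_mul_of_nonneg_left hxy hαβ

/-- The consumption rate in excess of `m`, in units of `κ σ² / 2` where `κ = (1 - S) / S`, as a
function of the proportion `q` and of the logarithmic slope `z = -n' / (κ n)`: solving the
differential equation for `n` gives `n = m + (κ σ² / 2) * excess q z`. -/
def excess (q z : ℝ) : ℝ := z * q * (1 - q) ^ 2 / (1 + z * (1 - q))

lemma strictMonoOn_excess {q : ℝ} (hq : 0 < q) (hq1 : q ≠ 1) :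
    StrictMonoOn (excess q) {z | 0 < 1 + z * (1 - q)} := by
  intro z hz w hw hzw
  have hq1' : 1 - q ≠ 0 := sub_ne_zero.2 hq1.symm
  rw [excess, excess, div_lt_div_iff₀ hz.out hw.out]
  have hpos := mul_pos (mul_pos hq (sq_pos_of_ne_zero hq1')) (sub_pos.2 hzw)
  linear_combination hpos

lemma excess_nonneg {q z : ℝ} (hq : 0 ≤ q) (hz : 0 ≤ z) (hdom : 0 < 1 + z * (1 - q)) :
    0 ≤ excess q z := by
  rw [excess]
  positivity

namespace Market

variable {P : Market} {R R' q : ℝ}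

/-- The coefficient `κ = (1 - S) / S` common to `m`, `ℓ` and the differential equation. -/
def kap (P : Market) : ℝ := (1 - P.S) / P.S

lemma kap_ne_zero (P : Market) : P.kap ≠ 0 :=
  div_ne_zero (sub_ne_zero.2 P.S_ne_one.symm) P.S_pos.ne'

lemma kap_pos (hS : P.S < 1) : 0 < P.kap := div_pos (sub_pos.2 hS) P.S_pos

lemma kap_neg (hS : 1 < P.S) : P.kap < 0 := div_neg_of_neg_of_pos (sub_neg.2 hS) P.S_pos

lemma S_mul_kap (P : Market) : P.S * P.kap = 1 - P.S := mul_div_cancel₀ _ P.S_pos.ne'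

lemma kap_mul_sq_ne_zero (P : Market) : P.kap * (P.σ ^ 2 / 2) ≠ 0 :=
  mul_ne_zero P.kap_ne_zero (div_pos (pow_pos P.σ_pos 2) two_pos).ne'

lemma kap_mul_sq_neg (hS : 1 < P.S) : P.kap * (P.σ ^ 2 / 2) < 0 :=
  mul_neg_of_neg_of_pos (kap_neg hS) (div_pos (pow_pos P.σ_pos 2) two_pos)

lemma AdmissibleR.lt_one_and_kap_pos_or (hR : P.AdmissibleR R) :
    (R < 1 ∧ 0 < P.kap) ∨ (1 < R ∧ P.kap < 0) := by
  rcases div_pos_iff.1 hR.2.2 with ⟨hR1, hS⟩ | ⟨hR1, hS⟩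
  · exact .inl ⟨sub_pos.1 hR1, kap_pos (sub_pos.1 hS)⟩
  · exact .inr ⟨sub_neg.1 hR1, kap_neg (sub_neg.1 hS)⟩

lemma AdmissibleR.qM_pos (hR : P.AdmissibleR R) (hlam : 0 < P.lam) : 0 < P.qM R :=
  div_pos hlam (mul_pos hR.1 P.σ_pos)

lemma qM_lt_qM (hlam : 0 < P.lam) (hR' : 0 < R') (hRR : R' < R) : P.qM R < P.qM R' :=
  div_lt_div_of_pos_left hlam (mul_pos hR' P.σ_pos) (mul_lt_mul_of_pos_right hRR P.σ_pos)

lemma m_eq (P : Market) (R q : ℝ) :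
    P.m R q = P.m R 0 - P.kap * P.lam * P.σ * q + P.kap * (P.σ ^ 2 / 2) * R * q ^ 2 := by
  simp only [m, kap]
  ring

lemma m_sub_m (P : Market) (R R' q : ℝ) :
    P.m R q - P.m R' q = P.kap * (P.σ ^ 2 / 2) * (R - R') * q ^ 2 := by
  simp only [m, kap]
  ring

lemma hasDerivAt_m (P : Market) (R q : ℝ) :
    HasDerivAt (P.m R) (P.kap * P.σ * (P.σ * R * q - P.lam)) q := by
  rw [funext (P.m_eq R)]
  refine ((((hasDerivAt_id q).const_mul (P.kap * P.lam * P.σ)).const_sub (P.m R 0)).add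
    (((hasDerivAt_id q).pow 2).const_mul (P.kap * (P.σ ^ 2 / 2) * R))).congr_deriv ?_
  simp only [id_eq, Nat.cast_ofNat]
  ring

lemma ell_eq (P : Market) (R q : ℝ) :
    P.ell R q = P.m R q + P.kap * (P.σ ^ 2 / 2) * (q * (1 - q)) := by
  rw [kap, ← ell_sub_m]
  ring

lemma deriv_ell_zero (P : Market) (R : ℝ) :
    deriv (P.ell R) 0 = -(P.kap * P.σ * (P.lam - P.σ / 2)) := by
  rw [funext (P.ell_eq R)]
  refine (((P.hasDerivAt_m R 0).add (((hasDerivAt_id (0 : ℝ)).mul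
    ((hasDerivAt_id (0 : ℝ)).const_sub 1)).const_mul _)).congr_deriv ?_).deriv
  simp only [id_eq]
  ring

lemma deriv_ell_zero_nonneg (hS : 1 < P.S) (hσ : P.σ / 2 ≤ P.lam) :
    0 ≤ deriv (P.ell R) 0 := by
  rw [deriv_ell_zero]
  exact neg_nonneg.2 (mul_nonpos_of_nonpos_of_nonneg
    (mul_nonpos_of_nonpos_of_nonneg (kap_neg hS).le P.σ_pos.le) (sub_nonneg.2 hσ))

/-! ### The function `c` -/

/-- The logarithmic slope `-n' / (κ n)` of the multiples `n` of `q ^ 2`. -/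
def criticalSlope (P : Market) (q : ℝ) : ℝ := -2 / (P.kap * q)

lemma kap_mul_criticalSlope (P : Market) (hq : q ≠ 0) : P.kap * q * P.criticalSlope q = -2 :=
  mul_div_cancel₀ _ (mul_ne_zero P.kap_ne_zero hq)

lemma one_add_criticalSlope_mul (P : Market) (hq : q ≠ 0) :
    1 + P.criticalSlope q * (1 - q) = (2 * P.S - (P.S + 1) * q) / ((P.S - 1) * q) := by
  have hS1 : P.S - 1 ≠ 0 := sub_ne_zero.2 P.S_ne_one
  rw [eq_div_iff (mul_ne_zero hS1 hq)]
  linear_combination -(P.S * (1 - q)) * P.kap_mul_criticalSlope hq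
    + q * P.criticalSlope q * (1 - q) * P.S_mul_kap

lemma one_add_criticalSlope_mul_pos_iff (hS : 1 < P.S) (hq : 0 < q) :
    0 < 1 + P.criticalSlope q * (1 - q) ↔ 0 < 2 * P.S - (P.S + 1) * q := by
  rw [P.one_add_criticalSlope_mul hq.ne', div_pos_iff_of_pos_right (mul_pos (sub_pos.2 hS) hq)]

lemma cfun_eq (P : Market) (R q : ℝ) : P.cfun R q = P.m R q + P.kap * (P.σ ^ 2 / 2)
    * ((1 - (P.S - 1) * q / (2 * P.S - (P.S + 1) * q)) * (q * (1 - q))) := by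
  rw [cfun, ell_eq]
  ring

lemma one_sub_div_eq (hD : 2 * P.S - (P.S + 1) * q ≠ 0) :
    1 - (P.S - 1) * q / (2 * P.S - (P.S + 1) * q)
      = 2 * P.S * (1 - q) / (2 * P.S - (P.S + 1) * q) := by
  rw [one_sub_div hD]
  ring

lemma cfun_eq_m_add_excess (P : Market) (R : ℝ) (hq : q ≠ 0)
    (hD : 2 * P.S - (P.S + 1) * q ≠ 0) :
    P.cfun R q = P.m R q + P.kap * (P.σ ^ 2 / 2) * excess q (P.criticalSlope q) := by
  have hS1 : P.S - 1 ≠ 0 := sub_ne_zero.2 P.S_ne_one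
  have hcrit : P.criticalSlope q = 2 * P.S / ((P.S - 1) * q) := by
    rw [criticalSlope, div_eq_div_iff (mul_ne_zero P.kap_ne_zero hq) (mul_ne_zero hS1 hq)]
    linear_combination -2 * q * P.S_mul_kap
  rw [cfun_eq, one_sub_div_eq hD, excess, P.one_add_criticalSlope_mul hq, hcrit]
  field_simp

lemma hasDerivAt_cfun (P : Market) (R : ℝ) (hD : 2 * P.S - (P.S + 1) * q ≠ 0) :
    HasDerivAt (P.cfun R) (P.kap * P.σ * (P.σ * R * q - P.lam) + P.kap * (P.σ ^ 2 / 2)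
      * (-(2 * P.S * (P.S - 1) / (2 * P.S - (P.S + 1) * q) ^ 2) * (q * (1 - q))
        + 2 * P.S * (1 - q) / (2 * P.S - (P.S + 1) * q) * (1 - 2 * q))) q := by
  have hnum : HasDerivAt (fun x => (P.S - 1) * x) (P.S - 1) q := by
    simpa using (hasDerivAt_id q).const_mul (P.S - 1)
  have hden : HasDerivAt (fun x => 2 * P.S - (P.S + 1) * x) (-(P.S + 1)) q := by
    simpa using ((hasDerivAt_id q).const_mul (P.S + 1)).const_sub (2 * P.S)
  have hquad : HasDerivAt (fun x => x * (1 - x)) (1 - 2 * q) q :=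
    ((hasDerivAt_id q).mul ((hasDerivAt_id q).const_sub 1)).congr_deriv
      (by simp only [id_eq]; ring)
  rw [funext (P.cfun_eq R), ← one_sub_div_eq hD]
  refine ((P.hasDerivAt_m R q).add
    ((((hnum.fun_div hden hD).const_sub 1).mul hquad).const_mul _)).congr_deriv ?_
  ring

lemma two_mul_cfun_sub_mul_deriv (P : Market) (R : ℝ) (hD : 2 * P.S - (P.S + 1) * q ≠ 0) :
    2 * P.cfun R q - q * deriv (P.cfun R) q =
      2 * P.m R 0 - P.kap * P.lam * P.σ * q + P.kap * (P.σ ^ 2 / 2) * q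
        * (4 * P.S * ((1 - q) * (P.S - q)) / (2 * P.S - (P.S + 1) * q) ^ 2) := by
  rw [(P.hasDerivAt_cfun R hD).deriv, cfun_eq, one_sub_div_eq hD, P.m_eq R q]
  obtain ⟨D, hDe⟩ : ∃ D, D = 2 * P.S - (P.S + 1) * q := ⟨_, rfl⟩
  simp only [← hDe] at hD ⊢
  field_simp
  rw [hDe]
  ring

lemma le_two_mul_cfun_sub_mul_deriv (hS : 1 < P.S) (hq : 0 < q)
    (hD : 0 < 2 * P.S - (P.S + 1) * q) :
    2 * P.m R 0 + deriv (P.ell R) 0 * q ≤ 2 * P.cfun R q - q * deriv (P.cfun R) q := by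
  have hle_one : 4 * P.S * ((1 - q) * (P.S - q)) / (2 * P.S - (P.S + 1) * q) ^ 2 ≤ 1 := by
    rw [div_le_one (pow_pos hD 2)]
    linear_combination sq_nonneg ((P.S - 1) * q)
  rw [two_mul_cfun_sub_mul_deriv P R hD.ne', deriv_ell_zero]
  linear_combination mul_le_mul_of_nonpos_left hle_one
    (mul_neg_of_neg_of_pos (kap_mul_sq_neg hS) hq).le

lemma two_mul_cfun_sub_mul_deriv_pos_of_two_le (hS : 1 < P.S) (hm : 0 < P.m R 0) (hR : 2 ≤ R)
    (hq : 0 < q) (hD : 0 < 2 * P.S - (P.S + 1) * q) (hc : 0 < P.cfun R q) :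
    0 < 2 * P.cfun R q - q * deriv (P.cfun R) q := by
  have hkq : P.kap * (P.σ ^ 2 / 2) * q < 0 := mul_neg_of_neg_of_pos (kap_mul_sq_neg hS) hq
  set v := 2 * P.S * (1 - q) / (2 * P.S - (P.S + 1) * q) * (1 - q) with hv
  have hv1 : 1 < 2 * q + v := by
    rw [← sub_lt_iff_lt_add', hv, div_mul_eq_mul_div, lt_div_iff₀ hD]
    have hq2 : 0 < P.S + 1 - 2 * q := by nlinarith [sq_nonneg (P.S - 1)]
    linear_combination mul_pos hq hq2
  have hRq : 2 * q ≤ R * q := mul_le_mul_of_nonneg_right hR hq.le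
  have hcv : P.m R 0 + deriv (P.ell R) 0 * q
      = P.cfun R q - P.kap * (P.σ ^ 2 / 2) * q * (R * q + v - 1) := by
    rw [cfun_eq, one_sub_div_eq hD.ne', deriv_ell_zero, P.m_eq R q, hv]
    ring
  have hneg := mul_neg_of_neg_of_pos hkq (show 0 < R * q + v - 1 by linarith)
  linarith [le_two_mul_cfun_sub_mul_deriv (R := R) hS hq hD]

lemma two_mul_cfun_sub_mul_deriv_pos (hS : 1 < P.S) (hm : 0 < P.m R 0)
    (hcond : P.CfunCondition R ∨ 2 ≤ R ∨ 0 ≤ deriv (P.ell R) 0) (hq : 0 < q)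
    (hq1 : P.qM R ≤ 1 → q < 1) (hD : 0 < 2 * P.S - (P.S + 1) * q) (hc : 0 < P.cfun R q) :
    0 < 2 * P.cfun R q - q * deriv (P.cfun R) q := by
  rcases hcond with hcfun | hR | hell
  · rcases le_or_gt (P.qM R) 1 with hM | hM
    · exact hcfun.1 hM q ⟨hq, hq1 hM⟩
    · refine hcfun.2 hM q ⟨hq, ?_⟩
      rw [lt_div_iff₀ (by linarith)]
      linarith
  · exact two_mul_cfun_sub_mul_deriv_pos_of_two_le hS hm hR hq hD hc
  · linarith [le_two_mul_cfun_sub_mul_deriv (R := R) hS hq hD, mul_nonneg hell hq.le]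

/-! ### The logarithmic slope of a solution -/

/-- The logarithmic slope `Z = -n' / (κ n)` of the consumption rate `n` on `[a, b]`. -/
def logSlope (P : Market) (a b : ℝ) (n : ℝ → ℝ) (q : ℝ) : ℝ :=
  -(derivWithin n (Icc a b) q) / (P.kap * n q)

namespace IsFreeBoundarySolution

variable {a b a' b' : ℝ} {n n' : ℝ → ℝ}

lemma left_pos (h : P.IsFreeBoundarySolution R a b n) (hM : 0 < P.qM R) : 0 < a := by
  rcases lt_trichotomy (P.qM R) 1 with h1 | h1 | h1
  exacts [(h.loc_mid ⟨hM, h1⟩).1, (h.loc_one h1).1, (h.loc_gt h1).1]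

lemma left_lt_qM (h : P.IsFreeBoundarySolution R a b n) (hM : 0 < P.qM R) : a < P.qM R := by
  rcases lt_trichotomy (P.qM R) 1 with h1 | h1 | h1
  exacts [(h.loc_mid ⟨hM, h1⟩).2.1, by rw [h1, ← (h.loc_one h1).2]; exact h.lt, (h.loc_gt h1).2.1]

lemma qM_le_right (h : P.IsFreeBoundarySolution R a b n) (hM : 0 < P.qM R) : P.qM R ≤ b := by
  rcases lt_trichotomy (P.qM R) 1 with h1 | h1 | h1
  exacts [(h.loc_mid ⟨hM, h1⟩).2.2.1.le, by rw [h1, (h.loc_one h1).2], (h.loc_gt h1).2.2.1.le]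

lemma right_lt_one (h : P.IsFreeBoundarySolution R a b n) (hM : 0 < P.qM R) (hM1 : P.qM R < 1) :
    b < 1 :=
  (h.loc_mid ⟨hM, hM1⟩).2.2.2

lemma right_le_one (h : P.IsFreeBoundarySolution R a b n) (hM : 0 < P.qM R) (hM1 : P.qM R ≤ 1) :
    b ≤ 1 := by
  rcases hM1.lt_or_eq with h1 | h1
  exacts [(h.right_lt_one hM h1).le, (h.loc_one h1).2.le]

lemma pos_of_mem (h : P.IsFreeBoundarySolution R a b n) (hM : 0 < P.qM R) (hq : q ∈ Icc a b) :
    0 < q :=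
  (h.left_pos hM).trans_le hq.1

lemma hasDerivWithinAt (h : P.IsFreeBoundarySolution R a b n) (hq : q ∈ Icc a b) :
    HasDerivWithinAt n (-(P.kap * n q * P.logSlope a b n q)) (Icc a b) q := by
  refine ((h.contDiffOn.differentiableOn one_ne_zero) q hq).hasDerivWithinAt.congr_deriv ?_
  rw [logSlope, mul_div_cancel₀ _ (mul_ne_zero P.kap_ne_zero (h.pos q hq).ne'), neg_neg]

lemma continuousOn_logSlope (h : P.IsFreeBoundarySolution R a b n) :
    ContinuousOn (P.logSlope a b n) (Icc a b) :=
  (h.contDiffOn.continuousOn_derivWithin (uniqueDiffOn_Icc h.lt) le_rfl).neg.div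
    (continuousOn_const.mul h.contDiffOn.continuousOn)
    fun q hq => mul_ne_zero P.kap_ne_zero (h.pos q hq).ne'

lemma logSlope_nonneg (h : P.IsFreeBoundarySolution R a b n) (hR : P.AdmissibleR R)
    (hq : q ∈ Icc a b) : 0 ≤ P.logSlope a b n q := by
  have hn := (h.pos q hq).le
  rcases hR.lt_one_and_kap_pos_or with ⟨hR1, hκ⟩ | ⟨hR1, hκ⟩
  · exact div_nonneg (neg_nonneg.2 (h.anti hR1).derivWithin_nonpos) (mul_nonneg hκ.le hn)
  · exact div_nonneg_of_nonpos (neg_nonpos.2 (h.mono hR1).derivWithin_nonneg)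
      (mul_nonpos_of_nonpos_of_nonneg hκ.le hn)

lemma logSlope_left (h : P.IsFreeBoundarySolution R a b n) (ha : a ≠ 1) :
    P.logSlope a b n a = 0 := by
  rw [logSlope, h.left_deriv ha, neg_zero, zero_div]

lemma logSlope_right (h : P.IsFreeBoundarySolution R a b n) (hb : b ≠ 1) :
    P.logSlope a b n b = 0 := by
  rw [logSlope, h.right_deriv hb, neg_zero, zero_div]

lemma mul_logSlope_one (h : P.IsFreeBoundarySolution R a b n) (h1 : 1 ∈ Icc a b) :
    n 1 * P.logSlope a b n 1 = P.σ * (P.lam - P.σ * R) := by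
  have hn := (h.pos 1 h1).ne'
  have hκ := P.kap_ne_zero
  rw [logSlope, h.one_deriv h1, (P.hasDerivAt_m R 1).deriv]
  field_simp
  ring

lemma logSlope_mul_one_sub_mul (h : P.IsFreeBoundarySolution R a b n) (hq : q ∈ Icc a b)
    (hq1 : q ≠ 1) :
    P.logSlope a b n q * (1 - q) * (P.ell R q - n q) = n q - P.m R q := by
  have hn := (h.pos q hq).ne'
  have hκ := P.kap_ne_zero
  have hℓ : P.ell R q - n q ≠ 0 := sub_ne_zero.2 (h.ne_ell q hq hq1).symm
  have hq1' : 1 - q ≠ 0 := sub_ne_zero.2 hq1.symm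
  rw [logSlope, h.ode q hq hq1, odeRHS, ← kap]
  field_simp
  ring

lemma one_add_logSlope_mul_mul (h : P.IsFreeBoundarySolution R a b n) (hq : q ∈ Icc a b)
    (hq1 : q ≠ 1) : (1 + P.logSlope a b n q * (1 - q)) * (P.ell R q - n q)
      = P.kap * (P.σ ^ 2 / 2) * (q * (1 - q)) := by
  linear_combination h.logSlope_mul_one_sub_mul hq hq1 + P.ell_eq R q

lemma one_add_logSlope_mul_ne_zero (h : P.IsFreeBoundarySolution R a b n) (hM : 0 < P.qM R)
    (hq : q ∈ Icc a b) : 1 + P.logSlope a b n q * (1 - q) ≠ 0 := by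
  rcases eq_or_ne q 1 with rfl | hq1
  · simp
  · refine left_ne_zero_of_mul (b := P.ell R q - n q) ?_
    rw [h.one_add_logSlope_mul_mul hq hq1]
    exact mul_ne_zero P.kap_mul_sq_ne_zero
      (mul_ne_zero (h.pos_of_mem hM hq).ne' (sub_ne_zero.2 hq1.symm))

lemma one_add_logSlope_mul_pos (h : P.IsFreeBoundarySolution R a b n) (hM : 0 < P.qM R)
    (hR : P.AdmissibleR R) (hq : q ∈ Icc a b) : 0 < 1 + P.logSlope a b n q * (1 - q) := by
  rcases le_or_gt q 1 with hq1 | hq1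
  · linarith [mul_nonneg (h.logSlope_nonneg hR hq) (sub_nonneg.2 hq1)]
  · -- the expression is continuous, has no zero, and equals `1` at the right end point
    by_contra! hneg
    have hcont : ContinuousOn (fun x => 1 + P.logSlope a b n x * (1 - x)) (Icc q b) :=
      (continuousOn_const.add (h.continuousOn_logSlope.mul (by fun_prop))).mono
        (Icc_subset_Icc_left hq.1)
    have hb : P.logSlope a b n b = 0 := h.logSlope_right (hq1.trans_le hq.2).ne'
    obtain ⟨x, hx, hx0⟩ := intermediate_value_Icc hq.2 hcont ⟨hneg, by simp [hb]⟩
    exact h.one_add_logSlope_mul_ne_zero hM ⟨hq.1.trans hx.1, hx.2⟩ hx0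

lemma eq_m_add_excess (h : P.IsFreeBoundarySolution R a b n) (hM : 0 < P.qM R)
    (hq : q ∈ Icc a b) :
    n q = P.m R q + P.kap * (P.σ ^ 2 / 2) * excess q (P.logSlope a b n q) := by
  rcases eq_or_ne q 1 with rfl | hq1
  · simp [h.one_val hq, excess]
  · have hne := h.one_add_logSlope_mul_ne_zero hM hq
    rw [excess]
    field_simp
    linear_combination -2 * (1 + P.logSlope a b n q * (1 - q)) * h.logSlope_mul_one_sub_mul hq hq1
      + 2 * P.logSlope a b n q * (1 - q) * h.one_add_logSlope_mul_mul hq hq1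

lemma hasDerivWithinAt_excess (h : P.IsFreeBoundarySolution R a b n) (hM : 0 < P.qM R)
    (hq : q ∈ Icc a b) :
    HasDerivWithinAt (fun x => excess x (P.logSlope a b n x))
      (2 / P.σ * (P.lam - P.σ * R * q) - 2 / P.σ ^ 2 * (n q * P.logSlope a b n q))
      (Icc a b) q := by
  have hσ := P.σ_pos.ne'
  have hκ := P.kap_ne_zero
  have heq : ∀ x ∈ Icc a b, excess x (P.logSlope a b n x)
      = (n x - P.m R x) / (P.kap * (P.σ ^ 2 / 2)) := fun x hx => by
    rw [eq_div_iff P.kap_mul_sq_ne_zero]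
    linear_combination -h.eq_m_add_excess hM hx
  refine ((((h.hasDerivWithinAt hq).sub (P.hasDerivAt_m R q).hasDerivWithinAt).div_const
    (P.kap * (P.σ ^ 2 / 2))).congr heq (heq q hq)).congr_deriv ?_
  field_simp
  ring

lemma logSlope_pos (h : P.IsFreeBoundarySolution R a b n) (hM : 0 < P.qM R)
    (hR : P.AdmissibleR R) (hq : q ∈ Ioo a b) (hqM : q ≠ P.qM R) : 0 < P.logSlope a b n q := by
  refine (h.logSlope_nonneg hR (Ioo_subset_Icc_self hq)).lt_of_ne fun hzero => hqM ?_
  have hnhds := Icc_mem_nhds hq.1 hq.2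
  have hmin : IsLocalMin (fun x => excess x (P.logSlope a b n x)) q := by
    filter_upwards [hnhds] with x hx
    rw [← hzero, show excess q 0 = 0 by simp [excess]]
    exact excess_nonneg (h.pos_of_mem hM hx).le (h.logSlope_nonneg hR hx)
      (h.one_add_logSlope_mul_pos hM hR hx)
  have hderiv := hmin.hasDerivAt_eq_zero
    ((h.hasDerivWithinAt_excess hM (Ioo_subset_Icc_self hq)).hasDerivAt hnhds)
  have hσ := P.σ_pos.ne'
  have hR0 := hR.1.ne'
  rw [← hzero, mul_zero, mul_zero, sub_zero] at hderiv
  have hlam : P.lam - P.σ * R * q = 0 :=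
    (mul_eq_zero.1 hderiv).resolve_left (div_ne_zero two_ne_zero hσ)
  rw [qM, eq_div_iff (mul_ne_zero hR0 hσ)]
  linarith

lemma continuousOn_logSlope_div (h : P.IsFreeBoundarySolution R a b n) (hM : 0 < P.qM R) :
    ContinuousOn (fun q => P.logSlope a b n q / q) (Icc a b) :=
  h.continuousOn_logSlope.div continuousOn_id fun _ hq => (h.pos_of_mem hM hq).ne'

lemma log_ξ_eq (h : P.IsFreeBoundarySolution R a b n) (hM : 0 < P.qM R) :
    Real.log P.ξ = ∫ q in a..b, P.logSlope a b n q / q := by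
  rw [h.integral_eq, Real.log_exp]
  refine intervalIntegral.integral_congr_ae ?_
  filter_upwards [volume.ae_ne (1 : ℝ)] with q hq1 hq
  rw [uIoc_of_le h.lt.le] at hq
  have hqI : q ∈ Icc a b := Ioc_subset_Icc_self hq
  have hq0 : q ≠ 0 := (h.pos_of_mem hM hqI).ne'
  have hq1' : 1 - q ≠ 0 := sub_ne_zero.2 hq1.symm
  have hℓ : P.ell R q - n q ≠ 0 := sub_ne_zero.2 (h.ne_ell q hqI hq1).symm
  field_simp
  linear_combination -h.logSlope_mul_one_sub_mul hqI hq1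

lemma exists_logSlope_lt (h : P.IsFreeBoundarySolution R a b n)
    (h' : P.IsFreeBoundarySolution R' a' b' n') (hM : 0 < P.qM R) (hM' : 0 < P.qM R')
    (hR' : P.AdmissibleR R') (ha : a' ≤ a) (hb : b ≤ b')
    (hout : ∃ q ∈ Ioo a' a ∪ Ioo b b', q ≠ P.qM R') :
    ∃ q ∈ Icc a b, P.logSlope a' b' n' q < P.logSlope a b n q := by
  by_contra! hle
  obtain ⟨q, hq, hqM⟩ := hout
  have hqI : q ∈ Ioo a' b' := by
    rcases hq with hq | hq
    exacts [⟨hq.1, hq.2.trans (h.lt.trans_le hb)⟩, ⟨(ha.trans_lt h.lt).trans hq.1, hq.2⟩]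
  refine (integral_lt_integral_of_le_of_exists_pos_outside ha h.lt.le hb
    (h.continuousOn_logSlope_div hM) (h'.continuousOn_logSlope_div hM') ?_ ?_ ⟨q, hq, ?_⟩).ne
      ((h.log_ξ_eq hM).symm.trans (h'.log_ξ_eq hM'))
  · exact fun x hx => div_nonneg (h'.logSlope_nonneg hR' hx) (h'.pos_of_mem hM' hx).le
  · exact fun x hx => div_le_div_of_nonneg_right (hle x hx) (h.pos_of_mem hM hx).le
  · exact div_pos (h'.logSlope_pos hM' hR' hqI hqM)
      (h'.pos_of_mem hM' (Ioo_subset_Icc_self hqI))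

lemma log_ξ_lt (h : P.IsFreeBoundarySolution R a b n) (hM : 0 < P.qM R) (hR : P.AdmissibleR R)
    (ha : 1 < a) : Real.log P.ξ < Real.log (a / (a - 1)) := by
  have hone : ∀ x ∈ Icc a b, 1 < x := fun x hx => ha.trans_le hx.1
  have hderiv : ∀ x ∈ Icc a b, HasDerivAt (fun x => -Real.log (x / (x - 1)))
      (1 / (x * (x - 1))) x := fun x hx => by
    have hx0 : x ≠ 0 := (h.pos_of_mem hM hx).ne'
    have hx1 : x - 1 ≠ 0 := (sub_pos.2 (hone x hx)).ne'
    refine (((hasDerivAt_id x).fun_div ((hasDerivAt_id x).sub_const 1) hx1).log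
      (div_ne_zero hx0 hx1)).neg.congr_deriv ?_
    simp only [id_eq]
    field_simp
    ring
  have hbound : ∀ x ∈ Icc a b, P.logSlope a b n x / x ≤ 1 / (x * (x - 1)) := fun x hx => by
    have hx0 := h.pos_of_mem hM hx
    rw [div_le_div_iff₀ hx0 (mul_pos hx0 (sub_pos.2 (hone x hx)))]
    linear_combination x * (h.one_add_logSlope_mul_pos hM hR hx).le
  have hle := intervalIntegral.integral_le_sub_of_hasDeriv_right_of_le h.lt.le
    (fun x hx => (hderiv x hx).continuousAt.continuousWithinAt)
    (fun x hx => (hderiv x (Ioo_subset_Icc_self hx)).hasDerivWithinAt)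
    (h.continuousOn_logSlope_div hM).integrableOn_Icc
    (fun x hx => hbound x (Ioo_subset_Icc_self hx))
  have hb : 1 < b := ha.trans h.lt
  have hlog : 0 < Real.log (b / (b - 1)) :=
    Real.log_pos ((one_lt_div (sub_pos.2 hb)).2 (sub_one_lt b))
  rw [← h.log_ξ_eq hM] at hle
  linarith

/-- At the purchase boundary the shadow price is the buying price, which is `ξ` times the selling
price. The inequality says that liquidating the position there more than repays the debt `a - 1`. -/
lemma ξ_mul_left_sub_one_lt (h : P.IsFreeBoundarySolution R a b n) (hM : 0 < P.qM R)
    (hR : P.AdmissibleR R) : P.ξ * (a - 1) < a := by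
  have hξ : 0 < P.ξ := h.integral_eq ▸ Real.exp_pos _
  have ha0 := h.left_pos hM
  rcases le_or_gt a 1 with ha | ha
  · exact (mul_nonpos_of_nonneg_of_nonpos hξ.le (sub_nonpos.2 ha)).trans_lt ha0
  · have ha1 := sub_pos.2 ha
    rw [← lt_div_iff₀ ha1, ← Real.log_lt_log_iff hξ (div_pos ha0 ha1)]
    exact h.log_ξ_lt hM hR ha

lemma γup_add_mul_left_pos (h : P.IsFreeBoundarySolution R a b n) (hM : 0 < P.qM R)
    (hR : P.AdmissibleR R) : 0 < P.γup + (1 - P.γup) * a := by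
  rcases le_or_gt a 1 with ha | ha
  · linarith [mul_le_mul_of_nonneg_left ha (sub_nonneg.2 P.one_le_γup)]
  · have hle : P.γup * (a - 1) ≤ P.ξ * (a - 1) := mul_le_mul_of_nonneg_right
      (le_mul_of_one_le_right (zero_le_one.trans P.one_le_γup) P.one_le_γdn) (sub_pos.2 ha).le
    linarith [h.ξ_mul_left_sub_one_lt hM hR]

/-! ### Monotonicity of `q ^ 2 / n` -/

lemma logSlope_one_lt_criticalSlope (h : P.IsFreeBoundarySolution R a b n) (hlam : 0 < P.lam)
    (hS : 1 < P.S) (hm : 0 < P.m R 0) (h1 : 1 ∈ Icc a b) :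
    P.logSlope a b n 1 < P.criticalSlope 1 := by
  have hκ := kap_neg hS
  have hκlam : P.kap * P.lam * P.σ < 0 :=
    mul_neg_of_neg_of_pos (mul_neg_of_neg_of_pos hκ hlam) P.σ_pos
  have hprod : n 1 * (2 + P.kap * P.logSlope a b n 1) = 2 * P.m R 0 - P.kap * P.lam * P.σ := by
    linear_combination P.kap * h.mul_logSlope_one h1 + 2 * h.one_val h1 + 2 * P.m_eq R 1
  have hpos : 0 < 2 + P.kap * P.logSlope a b n 1 :=
    pos_of_mul_pos_right (hprod ▸ by linarith) (h.pos 1 h1).le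
  rw [criticalSlope, mul_one, lt_div_iff_of_neg hκ]
  linarith

lemma logSlope_left_lt_criticalSlope (h : P.IsFreeBoundarySolution R a b n) (hlam : 0 < P.lam)
    (hM : 0 < P.qM R) (hS : 1 < P.S) (hm : 0 < P.m R 0) :
    P.logSlope a b n a < P.criticalSlope a := by
  rcases eq_or_ne a 1 with rfl | ha
  · exact h.logSlope_one_lt_criticalSlope hlam hS hm (left_mem_Icc.2 h.lt.le)
  · rw [h.logSlope_left ha]
    exact div_pos_of_neg_of_neg (by norm_num)
      (mul_neg_of_neg_of_pos (kap_neg hS) (h.left_pos hM))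

lemma eventually_lt_cfun (h : P.IsFreeBoundarySolution R a b n) (hM : 0 < P.qM R) (hS : 1 < P.S)
    (hm : 0 < P.m R 0) (hcond : P.CfunCondition R ∨ 2 ≤ R ∨ 0 ≤ deriv (P.ell R) 0)
    (hq : q ∈ Ioc a b) (hq1 : q ≠ 1) (hD : 0 < 2 * P.S - (P.S + 1) * q)
    (hcross : P.criticalSlope q = P.logSlope a b n q) (hnc : P.cfun R q = n q) :
    ∀ᶠ x in 𝓝[<] q, n x < P.cfun R x := by
  have hqI := Ioc_subset_Icc_self hq
  have hq0 := h.pos_of_mem hM hqI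
  have hpos := two_mul_cfun_sub_mul_deriv_pos hS hm hcond hq0
    (fun hM1 => (hq.2.trans (h.right_le_one hM hM1)).lt_of_ne hq1) hD (hnc ▸ h.pos q hqI)
  have hc := (P.hasDerivAt_cfun R hD.ne').differentiableAt.hasDerivAt.hasDerivWithinAt (s := Iio q)
  have hn := (h.hasDerivWithinAt hqI).mono_of_mem_nhdsWithin (Icc_mem_nhdsLT_of_mem hq)
  have hneg : deriv (P.cfun R) q - -(P.kap * n q * P.logSlope a b n q) < 0 := by
    refine neg_of_mul_neg_right (a := q) ?_ hq0.le
    rw [← hcross]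
    linear_combination hpos + n q * P.kap_mul_criticalSlope hq0.ne' + 2 * hnc
  filter_upwards [eventually_lt_nhdsLT_of_deriv_neg (hc.sub hn) hneg] with x hx
  rwa [Pi.sub_apply, Pi.sub_apply, hnc, sub_self, sub_pos] at hx

lemma eventually_criticalSlope_lt_logSlope (h : P.IsFreeBoundarySolution R a b n)
    (hlam : 0 < P.lam) (hR : P.AdmissibleR R) (hS : 1 < P.S) (hm : 0 < P.m R 0)
    (hcond : P.CfunCondition R ∨ 2 ≤ R ∨ 0 ≤ deriv (P.ell R) 0) (hq : q ∈ Ioc a b)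
    (hcross : P.criticalSlope q = P.logSlope a b n q) :
    ∀ᶠ x in 𝓝[<] q, P.criticalSlope x < P.logSlope a b n x := by
  have hM := hR.qM_pos hlam
  have hqI := Ioc_subset_Icc_self hq
  have hq0 := h.pos_of_mem hM hqI
  have hq1 : q ≠ 1 := by
    rintro rfl
    exact (h.logSlope_one_lt_criticalSlope hlam hS hm hqI).ne' hcross
  have hD : 0 < 2 * P.S - (P.S + 1) * q := by
    rw [← one_add_criticalSlope_mul_pos_iff hS hq0, hcross]
    exact h.one_add_logSlope_mul_pos hM hR hqI
  have hnc : P.cfun R q = n q := by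
    rw [P.cfun_eq_m_add_excess R hq0.ne' hD.ne', hcross, h.eq_m_add_excess hM hqI]
  have hDx : ∀ᶠ x in 𝓝[<] q, 0 < 2 * P.S - (P.S + 1) * x := by
    have hcont : ContinuousAt (fun x => 2 * P.S - (P.S + 1) * x) q := by fun_prop
    exact (hcont.eventually_const_lt hD).filter_mono nhdsWithin_le_nhds
  have hx1 : ∀ᶠ x in 𝓝[<] q, x ≠ 1 := (eventually_ne_nhds hq1).filter_mono nhdsWithin_le_nhds
  filter_upwards [h.eventually_lt_cfun hM hS hm hcond hq hq1 hD hcross hnc, hDx, hx1,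
    Icc_mem_nhdsLT_of_mem hq] with x hx hDx hx1 hxI
  have hx0 := h.pos_of_mem hM hxI
  refine ((strictMonoOn_excess hx0 hx1).lt_iff_lt
    ((one_add_criticalSlope_mul_pos_iff hS hx0).2 hDx)
    (h.one_add_logSlope_mul_pos hM hR hxI)).1 ?_
  rw [P.cfun_eq_m_add_excess R hx0.ne' hDx.ne', h.eq_m_add_excess hM hxI] at hx
  exact lt_of_mul_lt_mul_of_nonpos_left (lt_of_add_lt_add_left hx) (kap_mul_sq_neg hS).le

lemma logSlope_lt_criticalSlope (h : P.IsFreeBoundarySolution R a b n) (hlam : 0 < P.lam)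
    (hR : P.AdmissibleR R) (hS : 1 < P.S) (hm : 0 < P.m R 0)
    (hcond : P.CfunCondition R ∨ 2 ≤ R ∨ 0 ≤ deriv (P.ell R) 0) (hq : q ∈ Icc a b) :
    P.logSlope a b n q < P.criticalSlope q := by
  have hM := hR.qM_pos hlam
  by_contra! hle
  have hsub : Icc a q ⊆ Icc a b := Icc_subset_Icc_right hq.2
  have hcrit : ContinuousOn P.criticalSlope (Icc a q) :=
    continuousOn_const.div (continuousOn_const.mul continuousOn_id) fun x hx =>
      mul_ne_zero P.kap_ne_zero (h.pos_of_mem hM (hsub hx)).ne'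
  refine (h.logSlope_left_lt_criticalSlope hlam hM hS hm).not_ge <|
    le_on_Icc_of_le_right hcrit (h.continuousOn_logSlope.mono hsub) hle
      (fun x hx hcross => ?_) a (left_mem_Icc.2 hq.1)
  exact (h.eventually_criticalSlope_lt_logSlope hlam hR hS hm hcond
    ⟨hx.1, hx.2.trans hq.2⟩ hcross).mono fun _ => le_of_lt

lemma two_add_kap_mul_logSlope_pos (h : P.IsFreeBoundarySolution R a b n) (hlam : 0 < P.lam)
    (hR : P.AdmissibleR R) (hsc : P.SufficientCondition R) (hq : q ∈ Icc a b) :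
    0 < 2 + P.kap * q * P.logSlope a b n q := by
  have hq0 := h.pos_of_mem (hR.qM_pos hlam) hq
  rcases hsc with hS | ⟨hS, hm, hcond⟩
  · have hκ := kap_pos hS
    have hZ := h.logSlope_nonneg hR hq
    positivity
  · have hlt := h.logSlope_lt_criticalSlope hlam hR hS hm hcond hq
    rw [criticalSlope, lt_div_iff_of_neg (mul_neg_of_neg_of_pos (kap_neg hS) hq0)] at hlt
    linarith

/-! ### Comparison of two solutions -/

section Comparison

variable (hlam : 0 < P.lam) (hRR : R' < R) (hR : P.AdmissibleR R) (hR' : P.AdmissibleR R')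
  (hsc : P.SufficientCondition R) (h : P.IsFreeBoundarySolution R a b n)
  (h' : P.IsFreeBoundarySolution R' a' b' n')

include hlam hRR hR hsc h h' in
lemma logSlope_one_lt (h1 : 1 ∈ Icc a b) (h1' : 1 ∈ Icc a' b') :
    P.logSlope a b n 1 < P.logSlope a' b' n' 1 := by
  have hpos := mul_pos (mul_pos (div_pos (pow_pos P.σ_pos 2) two_pos) (sub_pos.2 hRR))
    (h.two_add_kap_mul_logSlope_pos hlam hR hsc h1)
  have hprod : n' 1 * (P.logSlope a' b' n' 1 - P.logSlope a b n 1)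
      = P.σ ^ 2 / 2 * (R - R') * (2 + P.kap * 1 * P.logSlope a b n 1) := by
    linear_combination h'.mul_logSlope_one h1' - h.mul_logSlope_one h1
      + P.logSlope a b n 1 * (h.one_val h1 - h'.one_val h1' + P.m_sub_m R R' 1)
  exact sub_pos.1 (pos_of_mul_pos_right (hprod ▸ hpos) (h'.pos 1 h1').le)

include hlam hRR hR hR' hsc h h'

lemma exists_hasDerivWithinAt_excess_sub_neg (hq : q ∈ Icc a b) (hq' : q ∈ Icc a' b')
    (hcross : P.logSlope a b n q = P.logSlope a' b' n' q) :
    ∃ d < 0, HasDerivWithinAt (fun x => excess x (P.logSlope a b n x)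
      - excess x (P.logSlope a' b' n' x)) d (Icc a b ∩ Icc a' b') q := by
  have hM := hR.qM_pos hlam
  have hM' := hR'.qM_pos hlam
  have hσ := P.σ_pos.ne'
  have hdiff : n q - n' q = P.kap * (P.σ ^ 2 / 2) * (R - R') * q ^ 2 := by
    rw [h.eq_m_add_excess hM hq, h'.eq_m_add_excess hM' hq', hcross]
    linear_combination P.m_sub_m R R' q
  refine ⟨-((R - R') * q * (2 + P.kap * q * P.logSlope a b n q)), ?_, ?_⟩
  · exact neg_neg_of_pos (mul_pos (mul_pos (sub_pos.2 hRR) (h.pos_of_mem hM hq))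
      (h.two_add_kap_mul_logSlope_pos hlam hR hsc hq))
  · refine (((h.hasDerivWithinAt_excess hM hq).mono inter_subset_left).sub
      ((h'.hasDerivWithinAt_excess hM' hq').mono inter_subset_right)).congr_deriv ?_
    rw [← hcross]
    field_simp
    linear_combination -2 * P.logSlope a b n q * hdiff

lemma eventually_logSlope_lt_nhdsGT (hq : q ∈ Ico a b) (hq' : q ∈ Ico a' b')
    (hcross : P.logSlope a b n q = P.logSlope a' b' n' q) :
    ∀ᶠ x in 𝓝[>] q, P.logSlope a b n x < P.logSlope a' b' n' x := by
  have hqI := Ico_subset_Icc_self hq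
  have hqI' := Ico_subset_Icc_self hq'
  have hmem : Icc a b ∩ Icc a' b' ∈ 𝓝[>] q :=
    inter_mem (Icc_mem_nhdsGT_of_mem hq) (Icc_mem_nhdsGT_of_mem hq')
  have hq1 : q ≠ 1 := by
    rintro rfl
    exact (h.logSlope_one_lt hlam hRR hR hsc h' hqI hqI').ne hcross
  obtain ⟨d, hd, hderiv⟩ :=
    h.exists_hasDerivWithinAt_excess_sub_neg hlam hRR hR hR' hsc h' hqI hqI' hcross
  filter_upwards [eventually_lt_nhdsGT_of_deriv_neg (hderiv.mono_of_mem_nhdsWithin hmem) hd,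
    (eventually_ne_nhds hq1).filter_mono nhdsWithin_le_nhds, hmem] with x hx hx1 hxI
  rw [hcross, sub_self, sub_neg] at hx
  have hM := hR.qM_pos hlam
  exact ((strictMonoOn_excess (h.pos_of_mem hM hxI.1) hx1).lt_iff_lt
    (h.one_add_logSlope_mul_pos hM hR hxI.1)
    (h'.one_add_logSlope_mul_pos (hR'.qM_pos hlam) hR' hxI.2)).1 hx

lemma eventually_logSlope_lt_nhdsLT (hq : q ∈ Ioc a b) (hq' : q ∈ Ioc a' b')
    (hcross : P.logSlope a b n q = P.logSlope a' b' n' q) :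
    ∀ᶠ x in 𝓝[<] q, P.logSlope a' b' n' x < P.logSlope a b n x := by
  have hqI := Ioc_subset_Icc_self hq
  have hqI' := Ioc_subset_Icc_self hq'
  have hmem : Icc a b ∩ Icc a' b' ∈ 𝓝[<] q :=
    inter_mem (Icc_mem_nhdsLT_of_mem hq) (Icc_mem_nhdsLT_of_mem hq')
  have hq1 : q ≠ 1 := by
    rintro rfl
    exact (h.logSlope_one_lt hlam hRR hR hsc h' hqI hqI').ne hcross
  obtain ⟨d, hd, hderiv⟩ :=
    h.exists_hasDerivWithinAt_excess_sub_neg hlam hRR hR hR' hsc h' hqI hqI' hcross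
  filter_upwards [eventually_lt_nhdsLT_of_deriv_neg (hderiv.mono_of_mem_nhdsWithin hmem) hd,
    (eventually_ne_nhds hq1).filter_mono nhdsWithin_le_nhds, hmem] with x hx hx1 hxI
  rw [hcross, sub_self, sub_pos] at hx
  have hM := hR.qM_pos hlam
  exact ((strictMonoOn_excess (h.pos_of_mem hM hxI.1) hx1).lt_iff_lt
    (h'.one_add_logSlope_mul_pos (hR'.qM_pos hlam) hR' hxI.2)
    (h.one_add_logSlope_mul_pos hM hR hxI.1)).1 hx

lemma logSlope_le_of_le_left {α β : ℝ} (hI : Icc α β ⊆ Icc a b) (hI' : Icc α β ⊆ Icc a' b')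
    (hα : P.logSlope a b n α ≤ P.logSlope a' b' n' α) :
    ∀ x ∈ Icc α β, P.logSlope a b n x ≤ P.logSlope a' b' n' x := by
  refine le_on_Icc_of_le_left (h.continuousOn_logSlope.mono hI)
    (h'.continuousOn_logSlope.mono hI') hα fun x hx hcross => ?_
  have hβ := right_mem_Icc.2 (hx.1.trans hx.2.le)
  exact (h.eventually_logSlope_lt_nhdsGT hlam hRR hR hR' hsc h'
    ⟨(hI (Ico_subset_Icc_self hx)).1, hx.2.trans_le (hI hβ).2⟩
    ⟨(hI' (Ico_subset_Icc_self hx)).1, hx.2.trans_le (hI' hβ).2⟩ hcross).mono fun _ => le_of_lt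

lemma logSlope_le_of_le_right {α β : ℝ} (hI : Icc α β ⊆ Icc a b) (hI' : Icc α β ⊆ Icc a' b')
    (hβ : P.logSlope a' b' n' β ≤ P.logSlope a b n β) :
    ∀ x ∈ Icc α β, P.logSlope a' b' n' x ≤ P.logSlope a b n x := by
  refine le_on_Icc_of_le_right (h'.continuousOn_logSlope.mono hI')
    (h.continuousOn_logSlope.mono hI) hβ fun x hx hcross => ?_
  have hα := left_mem_Icc.2 (hx.1.le.trans hx.2)
  exact (h.eventually_logSlope_lt_nhdsLT hlam hRR hR hR' hsc h'
    ⟨(hI hα).1.trans_lt hx.1, (hI (Ioc_subset_Icc_self hx)).2⟩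
    ⟨(hI' hα).1.trans_lt hx.1, (hI' (Ioc_subset_Icc_self hx)).2⟩ hcross.symm).mono
      fun _ => le_of_lt

lemma left_le : a ≤ a' := by
  by_contra! hlt
  have hM := hR.qM_pos hlam
  have hM' := hR'.qM_pos hlam
  have hMM := qM_lt_qM hlam hR'.1 hRR
  have hMb' : P.qM R < b' := hMM.trans_le (h'.qM_le_right hM')
  have haM := h.left_lt_qM hM
  have hab' := haM.trans hMb'
  have hmem' : a ∈ Icc a' b' := ⟨hlt.le, hab'.le⟩
  have hstart : P.logSlope a b n a ≤ P.logSlope a' b' n' a := by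
    rcases eq_or_ne a 1 with rfl | ha
    · exact (h.logSlope_one_lt hlam hRR hR hsc h' (left_mem_Icc.2 h.lt.le) hmem').le
    · rw [h.logSlope_left ha]
      exact h'.logSlope_nonneg hR' hmem'
  have hle := h.logSlope_le_of_le_left hlam hRR hR hR' hsc h'
    (Icc_subset_Icc_right (min_le_left b b')) (Icc_subset_Icc hlt.le (min_le_right b b')) hstart
  have hbb' : b ≤ b' := by
    by_contra! hb
    have hb'1 : b' ≠ 1 := by
      rintro rfl
      exact (h.right_lt_one hM hMb').not_gt hb
    refine (h.logSlope_pos hM hR ⟨hab', hb⟩ hMb'.ne').not_ge ?_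
    rw [← h'.logSlope_right hb'1]
    exact hle b' ⟨hab'.le, le_min hb.le le_rfl⟩
  rw [min_eq_left hbb'] at hle
  obtain ⟨x, hx⟩ := exists_between hlt
  obtain ⟨q, hq, hlt_q⟩ := h.exists_logSlope_lt h' hM hM' hR' hlt.le hbb'
    ⟨x, .inl hx, (hx.2.trans (haM.trans hMM)).ne⟩
  exact hlt_q.not_ge (hle q hq)

lemma right_le : b ≤ b' := by
  by_contra! hlt
  have hM := hR.qM_pos hlam
  have hM' := hR'.qM_pos hlam
  have hMb' := (qM_lt_qM hlam hR'.1 hRR).trans_le (h'.qM_le_right hM')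
  have ha := h.left_le hlam hRR hR hR' hsc h'
  have hb'1 : b' ≠ 1 := by
    rintro rfl
    exact (h.right_lt_one hM hMb').not_gt hlt
  have hend : P.logSlope a' b' n' b' ≤ P.logSlope a b n b' := by
    rw [h'.logSlope_right hb'1]
    exact h.logSlope_nonneg hR ⟨ha.trans h'.lt.le, hlt.le⟩
  obtain ⟨x, hx⟩ := exists_between hlt
  obtain ⟨q, hq, hlt_q⟩ := h'.exists_logSlope_lt h hM' hM hR ha hlt.le
    ⟨x, .inr hx, (hMb'.trans hx.1).ne'⟩
  exact hlt_q.not_ge (h.logSlope_le_of_le_right hlam hRR hR hR' hsc h'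
    (Icc_subset_Icc ha hlt.le) subset_rfl hend q hq)

end Comparison

end IsFreeBoundarySolution
end Market
end EpsteinZin
end

theorem proposition7p3_general (P : EpsteinZin.Market) (hlam : 0 < P.lam) {R R' : ℝ}
    (hRR : R' < R) (hR : P.AdmissibleR R) (hR' : P.AdmissibleR R') (hsc : P.SufficientCondition R)
    {pl pu pl' pu' : ℝ} (hp : P.IsBoundaryPair R pl pu) (hp' : P.IsBoundaryPair R' pl' pu') :
    pl ≤ pl' ∧ pu ≤ pu' := by
  obtain ⟨a, b, n, h, rfl, rfl⟩ := hp
  obtain ⟨a', b', n', h', rfl, rfl⟩ := hp'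
  have hM := hR.qM_pos hlam
  have hM' := hR'.qM_pos hlam
  have hup := zero_le_one.trans P.one_le_γup
  have hdn := zero_le_one.trans P.one_le_γdn
  have hdn' := sub_nonneg.2 P.one_le_γdn
  have hb := (h.left_pos hM).le.trans h.lt.le
  have hb' := (h'.left_pos hM').le.trans h'.lt.le
  constructor
  · simpa only [one_mul] using EpsteinZin.mul_div_add_mul_le_mul_div_add_mul (α := 1)
      (by rwa [one_mul]) (h.γup_add_mul_left_pos hM hR) (h'.γup_add_mul_left_pos hM' hR')
      (h.left_le hlam hRR hR hR' hsc h')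
  · exact EpsteinZin.mul_div_add_mul_le_mul_div_add_mul (by rwa [mul_one]) (by positivity)
      (by positivity) (h.right_le hlam hRR hR hR' hsc h')

theorem proposition7p3 (P : EpsteinZin.Market) (hlam : 0 < P.lam) :
    -- comparison of two coefficients of relative risk aversion `R' < R`
    (∀ R R' : ℝ, R' < R → P.AdmissibleR R → P.AdmissibleR R' →
      P.WellPosed R → P.WellPosed R' →
      P.SufficientCondition R → P.SufficientCondition R' →
      ∀ pl pu pl' pu' : ℝ, P.IsBoundaryPair R pl pu → P.IsBoundaryPair R' pl' pu' →
        pl ≤ pl' ∧ pu ≤ pu') ∧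
    -- monotonicity in `R`; note that `m(0)` does not depend on `R`
    (P.S < 1 → P.BoundariesDecreaseOn (Set.Ioo 0 1)) ∧
    (1 < P.S → P.BoundariesDecreaseOn {R | 2 ≤ R ∧ 0 < P.m R 0}) ∧
    (1 < P.S → P.σ / 2 ≤ P.lam → P.BoundariesDecreaseOn {R | 1 < R ∧ 0 < P.m R 0}) := by
  have hdecr {A : Set ℝ} (hA : ∀ R ∈ A, P.SufficientCondition R) : P.BoundariesDecreaseOn A :=
    fun _ _ R₂ hR₂ hRR hR₁ hR₂' _ _ _ _ _ _ hp₁ hp₂ =>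
      proposition7p3_general P hlam hRR hR₂' hR₁ (hA R₂ hR₂) hp₂ hp₁
  refine ⟨?_, fun hS => ?_, fun hS => ?_, fun hS hσ => ?_⟩
  · exact fun R R' hRR hR hR' _ _ hsc _ _ _ _ _ hp hp' =>
      proposition7p3_general P hlam hRR hR hR' hsc hp hp'
  · exact hdecr fun _ _ => .inl hS
  · exact hdecr fun _ hR => .inr ⟨hS, hR.2, .inr (.inl hR.1)⟩
  · have hℓ (R : ℝ) : 0 ≤ deriv (P.ell R) 0 := EpsteinZin.Market.deriv_ell_zero_nonneg hS hσ
    exact hdecr fun R hR => .inr ⟨hS, hR.2, .inr (.inr (hℓ R))⟩
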